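/- Let $\mathcal M$ be a smooth finite-dimensional manifold without boundary, with a Riemannian metric $\langle\cdot,\cdot\rangle$ of class $C^2$ (for instance a smooth one), and let $\alpha:\mathcal M\to\mathbb R$ be a function of class $C^2$ with positive values. The condition metric is $\langle\cdot,\cdot\rangle_{\kappa,x}=\alpha(x)\langle\cdot,\cdot\rangle_x$, and $\alpha$ is called self-convex if, for every geodesic $\gamma$ of the condition metric, defined on an open interval, the function $t\mapsto\log\alpha(\gamma(t))$ is convex. (Geodesics are the $C^2$ solutions of the geodesic equation, i.e. they are affinely parametrized.) Let $D$ denote the differential, $D^2$ the covariant Hessian for the Levi-Civita connection of the original metric, $\|\dot x\|_x$ the norm of $\dot x\in T_x\mathcal M$ for the original metric, and $\|D f(x)\|_x$ the dual norm of the linear form $Df(x)$ on $T_x\mathcal M$. (1) The function $\alpha$ is self-convex if and only if, for every $x\in\mathcal M$ and every $\dot x\in T_x\mathcal M$, $$2\alpha(x)\,D^2\alpha(x)(\dot x,\dot x)+\|D\alpha(x)\|_x^2\,\|\dot x\|_x^2-4\,(D\alpha(x)\dot x)^2\ \ge\ 0 .$$ (2) If $\alpha=1/\rho^2$ with $\rho:\mathcal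 M\to\mathbb R$ of class $C^2$ and nowhere zero, then $\alpha$ is self-convex if and only if, for every $x\in\mathcal M$ and every $\dot x\in T_x\mathcal M$, $$\|\dot x\|_x^2\,\|D\rho(x)\|_x^2-(D\rho(x)\dot x)^2-\rho(x)\,D^2\rho(x)(\dot x,\dot x)\ \ge\ 0,$$ and also if and only if, for every $x\in\mathcal M$ and every $\dot x\in T_x\mathcal M$, $$2\,\|\dot x\|_x^2\,\|D\rho(x)\|_x^2\ \ge\ D^2\rho^2(x)(\dot x,\dot x),$$ where $D^2\rho^2$ is the covariant Hessian of the function $\rho^2$. -/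

import Mathlib

open Bundle Manifold Set
open scoped ContDiff Topology

noncomputable section

namespace SelfConvexity

variable {E : Type*} [NormedAddCommGroup E] [NormedSpace ℝ E]
  {M : Type*} [TopologicalSpace M] [ChartedSpace E M] [IsManifold 𝓘(ℝ, E) ∞ M]

/-- Riemannian metrics of class `C²` on the boundaryless smooth manifold `M` modelled on `E`.
Every metric of class `C^∞` is in particular one of class `C²`. -/
abbrev Metric (E : Type*) [NormedAddCommGroup E] [NormedSpace ℝ E]
    (M : Type*) [TopologicalSpace M] [ChartedSpace E M] [IsManifold 𝓘(ℝ, E) ∞ M] : Type _ :=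
  ContMDiffRiemannianMetric 𝓘(ℝ, E) 2 E (fun x : M ↦ TangentSpace 𝓘(ℝ, E) x)

/-- The condition metric `α ⟨·,·⟩`, for a positive function `α` of class `C²`. -/
def conditionMetric (g : Metric E M) (α : M → ℝ)
    (hα : ContMDiff 𝓘(ℝ, E) 𝓘(ℝ, ℝ) 2 α) (hpos : ∀ x, 0 < α x) : Metric E M where
  inner x := α x • g.inner x
  symm x v w := by simp [g.symm x v w]
  pos x v hv := by
    simpa using mul_pos (hpos x) (g.pos x v hv)
  isVonNBounded x := by
    have hs : 0 < Real.sqrt (α x) := Real.sqrt_pos.2 (hpos x)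
    have h := (g.isVonNBounded x).image
      ((Real.sqrt (α x))⁻¹ • ContinuousLinearMap.id ℝ (TangentSpace 𝓘(ℝ, E) x))
    refine h.subset fun v hv ↦ (Set.mem_image _ _ _).2 ⟨Real.sqrt (α x) • v, ?_, ?_⟩
    · have h1 : α x * g.inner x v v < 1 := by simpa using hv
      have h2 : Real.sqrt (α x) * (Real.sqrt (α x) * g.inner x v v) = α x * g.inner x v v := by
        rw [← mul_assoc, Real.mul_self_sqrt (hpos x).le]
      simpa [h2] using h1
    · simp [smul_smul, mul_inv_cancel₀ hs.ne']
  contMDiff := hα.smul_section g.contMDiff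

/-- The first fundamental form `G` of `g` in the coordinate system given by the chart at `x₀`:
with `φ` the inverse of the chart, `G z u v = ⟨dφ(z) u, dφ(z) v⟩_{φ z}`. -/
def coordMetric (g : Metric E M) (x₀ : M) (z : E) : E →L[ℝ] E →L[ℝ] ℝ :=
  let dφ : E →L[ℝ] E := mfderiv 𝓘(ℝ, E) 𝓘(ℝ, E) (extChartAt 𝓘(ℝ, E) x₀).symm z
  let B : E →L[ℝ] E →L[ℝ] ℝ := g.inner ((extChartAt 𝓘(ℝ, E) x₀).symm z)
  B.bilinearComp dφ dφ

/-- The Christoffel symbols of the Levi-Civita connection of `g` in the chart at `x₀`, as the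
bilinear map `(u, v) ↦ ∑ Γⁱⱼₖ uʲ vᵏ eᵢ`: the value `c` at the coordinate point `z` is determined by
`G z c w = (DG(z)[u](v, w) + DG(z)[v](u, w) - DG(z)[w](u, v)) / 2` for all `w`
(`G z` is invertible as a map from `E` to its dual, for `z` in the image of the chart). -/
def christoffel (g : Metric E M) (x₀ : M) (z u v : E) : E :=
  (coordMetric g x₀ z).inverse ((1 / 2 : ℝ) • (fderiv ℝ (coordMetric g x₀) z u v
    + fderiv ℝ (coordMetric g x₀) z v u - ((fderiv ℝ (coordMetric g x₀) z).flip u).flip v))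

/-- `γ` is a geodesic of `g` on the open interval `s`: it is of class `C²` there and, in
coordinates, it satisfies `c'' + Γ(c', c') = 0`. -/
def IsGeodesicOn (g : Metric E M) (γ : ℝ → M) (s : Set ℝ) : Prop :=
  ContMDiffOn 𝓘(ℝ, ℝ) 𝓘(ℝ, E) 2 γ s ∧
    ∀ x₀ : M, ∀ t ∈ s, γ t ∈ (chartAt E x₀).source →
      let c : ℝ → E := fun r ↦ extChartAt 𝓘(ℝ, E) x₀ (γ r)
      deriv (deriv c) t + christoffel g x₀ (c t) (deriv c t) (deriv c t) = 0

/-- `α` is self-convex: `log (α (γ t))` is convex along every geodesic `γ` of the condition metric,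
defined on any open interval. -/
def SelfConvex (g : Metric E M) (α : M → ℝ)
    (hα : ContMDiff 𝓘(ℝ, E) 𝓘(ℝ, ℝ) 2 α) (hpos : ∀ x, 0 < α x) : Prop :=
  ∀ (γ : ℝ → M) (s : Set ℝ), IsOpen s → s.OrdConnected →
    IsGeodesicOn (conditionMetric g α hα hpos) γ s →
      ConvexOn ℝ s fun t ↦ Real.log (α (γ t))

/-- The covariant Hessian `D²f(x)(u, v)` of a function of class `C²`. With `F` the expression of `f`
in the chart at `x`, `z` the image of `x`, and `a`, `b` the coordinates of `u`, `v`, it is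
`D²F(z)(a, b) - DF(z)(Γ(a, b))`. -/
def hessian (g : Metric E M) (f : M → ℝ) (x : M) (u v : TangentSpace 𝓘(ℝ, E) x) : ℝ :=
  let z : E := extChartAt 𝓘(ℝ, E) x x
  let F : E → ℝ := fun y ↦ f ((extChartAt 𝓘(ℝ, E) x).symm y)
  let a : E := mfderiv 𝓘(ℝ, E) 𝓘(ℝ, E) (extChartAt 𝓘(ℝ, E) x) x u
  let b : E := mfderiv 𝓘(ℝ, E) 𝓘(ℝ, E) (extChartAt 𝓘(ℝ, E) x) x v
  fderiv ℝ (fderiv ℝ F) z a b - fderiv ℝ F z (christoffel g x z a b)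

/-- The squared length `‖u‖ₓ²` of a tangent vector. -/
def normSq (g : Metric E M) (x : M) (u : TangentSpace 𝓘(ℝ, E) x) : ℝ := g.inner x u u

/-- The norm `‖ℓ‖ₓ` of a linear form on the tangent space at `x`, dual to the norm given by `g`. -/
def dualNorm (g : Metric E M) (x : M) (l : TangentSpace 𝓘(ℝ, E) x →L[ℝ] ℝ) : ℝ :=
  sSup {r : ℝ | ∃ u : TangentSpace 𝓘(ℝ, E) x, normSq g x u ≤ 1 ∧ r = |l u|}

end SelfConvexity

end

/-! The sign condition is a second-derivative test. Changing a metric `G` to `a • G` adds `(Da(u) u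
- ½ G(u,u) n) / a` to the diagonal Christoffel symbol `Γ(u,u)`, where `n` is the `G`-gradient of `a`
(`leviCivita_smul`). Substituting the geodesic equation of `a • G` into the second derivative of
`log a` along a curve `c` gives exactly `(2 a²)⁻¹` times the quadratic form of (1) at the velocity
(`deriv_deriv_log_comp`).

If the form is nonnegative, `log α` is therefore convex along every geodesic of the condition
metric. Conversely, every tangent vector is the initial velocity of such a geodesic
(`exists_geodesic`), so convexity forces the form to be nonnegative at that vector. Existence comes
from Picard–Lindelöf in one chart; the transformation law of the Christoffel symbols
(`fderiv_leviCivita`) carries the equation to all the others.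

For (2), the chain rule for Hessians turns the form for `1/ρ²` into `4/ρ⁶` times the form in `ρ`
(`convexityForm_inv_sq`), and `D²ρ² = 2 (Dρ)² + 2 ρ D²ρ` gives the last version. -/

namespace SelfConvexity

/-! ### Norms on spaces of linear and bilinear maps -/

section Instances

variable {X F₁ F₂ F₃ : Type*} [NormedAddCommGroup X] [NormedSpace ℝ X]
  [NormedAddCommGroup F₁] [NormedSpace ℝ F₁] [NormedAddCommGroup F₂] [NormedSpace ℝ F₂]
  [NormedAddCommGroup F₃] [NormedSpace ℝ F₃]

noncomputable instance instNormedAddCommGroupCLM : NormedAddCommGroup (F₁ →L[ℝ] F₂) :=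
  ContinuousLinearMap.toNormedAddCommGroup

noncomputable instance instNormedSpaceCLM : NormedSpace ℝ (F₁ →L[ℝ] F₂) :=
  ContinuousLinearMap.toNormedSpace

noncomputable instance instNormedAddCommGroupBilin : NormedAddCommGroup (F₁ →L[ℝ] F₂ →L[ℝ] F₃) :=
  ContinuousLinearMap.toNormedAddCommGroup

noncomputable instance instNormedSpaceBilin : NormedSpace ℝ (F₁ →L[ℝ] F₂ →L[ℝ] F₃) :=
  ContinuousLinearMap.toNormedSpace

theorem contDiffAt_flip {n : WithTop ℕ∞} {f : X → F₁ →L[ℝ] F₂ →L[ℝ] F₃} {x : X}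
    (hf : ContDiffAt ℝ n f x) : ContDiffAt ℝ n (fun p ↦ (f p).flip) x :=
  ((ContinuousLinearMap.flipₗᵢ ℝ F₁ F₂ F₃).contDiff (n := n)).contDiffAt.comp x hf

end Instances

/-! ### Scalar products on a vector space -/

section Calculus

variable {E : Type*} [NormedAddCommGroup E] [NormedSpace ℝ E]

/-- A bilinear form that is symmetric, positive definite and nondegenerate in the strong sense. -/
structure IsScalarProduct (B : E →L[ℝ] E →L[ℝ] ℝ) : Prop where
  symm : ∀ u v, B u v = B v u
  pos : ∀ u, u ≠ 0 → 0 < B u u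
  isInvertible : B.IsInvertible

theorem IsScalarProduct.of_finiteDimensional [FiniteDimensional ℝ E] {B : E →L[ℝ] E →L[ℝ] ℝ}
    (symm : ∀ u v, B u v = B v u) (pos : ∀ u, u ≠ 0 → 0 < B u u) : IsScalarProduct B := by
  refine ⟨symm, pos, ?_⟩
  have hinj : Function.Injective B := by
    rw [injective_iff_map_eq_zero]
    intro u hu
    by_contra h
    have := pos u h
    simp [hu] at this
  -- An injective map into the dual, which has the same dimension, is an isomorphism.
  have hd : Module.finrank ℝ E = Module.finrank ℝ (E →L[ℝ] ℝ) := by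
    rw [← (LinearMap.toContinuousLinearMap (𝕜 := ℝ) (E := E) (F' := ℝ)).finrank_eq]
    exact (Subspace.dual_finrank_eq (K := ℝ) (V := E)).symm
  refine ⟨(LinearEquiv.ofInjectiveOfFinrankEq (B : E →ₗ[ℝ] E →L[ℝ] ℝ) hinj
    hd).toContinuousLinearEquiv, ?_⟩
  ext u v
  rfl

/-- The Christoffel symbols of a field of bilinear forms on a vector space. -/
noncomputable def leviCivita (G : E → E →L[ℝ] E →L[ℝ] ℝ) (z u v : E) : E :=
  (G z).inverse ((1 / 2 : ℝ) • (fderiv ℝ G z u v + fderiv ℝ G z v u - ((fderiv ℝ G z).flip u).flip v))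

namespace IsScalarProduct

variable {B : E →L[ℝ] E →L[ℝ] ℝ}

theorem injective (hB : IsScalarProduct B) : Function.Injective B := by
  obtain ⟨e, rfl⟩ := hB.isInvertible
  exact e.injective

theorem eq_of_forall (hB : IsScalarProduct B) {u v : E} (h : ∀ w, B u w = B v w) : u = v :=
  hB.injective (ContinuousLinearMap.ext h)

theorem smul (hB : IsScalarProduct B) {a : ℝ} (ha : 0 < a) : IsScalarProduct (a • B) where
  symm u v := by simp [hB.symm u v]
  pos u hu := by simpa using mul_pos ha (hB.pos u hu)
  isInvertible := by
    obtain ⟨e, rfl⟩ := hB.isInvertible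
    refine ⟨e.trans (ContinuousLinearEquiv.smulLeft (Units.mk0 a ha.ne')), ?_⟩
    ext u v
    rfl

theorem nonneg (hB : IsScalarProduct B) (u : E) : 0 ≤ B u u := by
  rcases eq_or_ne u 0 with rfl | hu
  · simp
  · exact (hB.pos u hu).le

/-- Cauchy–Schwarz: the squared length of `B(v,v) u - B(u,v) v` is `B(v,v)` times the difference of
the two sides. -/
theorem sq_le (hB : IsScalarProduct B) (u v : E) : B u v ^ 2 ≤ B u u * B v v := by
  rcases eq_or_ne v 0 with rfl | hv
  · simp
  have h := hB.nonneg (B v v • u - B u v • v)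
  have hp := hB.pos v hv
  have e : B (B v v • u - B u v • v) (B v v • u - B u v • v)
      = B v v * (B u u * B v v - B u v ^ 2) := by
    simp only [map_sub, map_smul, sub_apply, smul_apply,
      smul_eq_mul, hB.symm v u]
    ring
  rw [e] at h
  nlinarith [nonneg_of_mul_nonneg_right h hp]

/-- The square of the dual norm of `l` is the squared length of the vector representing `l`. -/
theorem sSup_sq (hB : IsScalarProduct B) {l : E →L[ℝ] ℝ} {n : E} (hn : B n = l) :
    (sSup {r : ℝ | ∃ u : E, B u u ≤ 1 ∧ r = |l u|}) ^ 2 = B n n := by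
  subst hn
  have h0 := hB.nonneg n
  suffices sSup {r : ℝ | ∃ u : E, B u u ≤ 1 ∧ r = |B n u|} = √(B n n) by
    rw [this, Real.sq_sqrt h0]
  apply IsGreatest.csSup_eq
  constructor
  · rcases eq_or_ne n 0 with rfl | hn
    · exact ⟨0, by simp⟩
    have hp := hB.pos n hn
    have hs := Real.sqrt_pos.2 hp
    have hq := Real.mul_self_sqrt h0
    -- The supremum is attained at the normalized gradient; Cauchy–Schwarz gives the upper bound.
    refine ⟨(√(B n n))⁻¹ • n, ?_, ?_⟩
    · simp only [map_smul, smul_apply, smul_eq_mul]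
      rw [← mul_assoc, ← mul_inv, hq, inv_mul_cancel₀ hp.ne']
    · simp only [map_smul, smul_eq_mul]
      rw [abs_of_pos (by positivity), eq_comm, inv_mul_eq_iff_eq_mul₀ hs.ne', hq]
  · rintro r ⟨u, hu, rfl⟩
    apply Real.abs_le_sqrt
    nlinarith [hB.sq_le n u]

theorem apply_inverse (hB : IsScalarProduct B) (l : E →L[ℝ] ℝ) : B (B.inverse l) = l := by
  obtain ⟨e, rfl⟩ := hB.isInvertible
  simp

end IsScalarProduct

/-! ### Christoffel symbols and the geodesic equation in coordinates -/

variable {G : E → E →L[ℝ] E →L[ℝ] ℝ} {z : E}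

/-- The Koszul formula for constant fields; with nondegeneracy it characterizes the symbols, so
later identities are tested against `w` and never meet the inverse. -/
theorem apply_leviCivita (hG : IsScalarProduct (G z)) (u v w : E) :
    2 * G z (leviCivita G z u v) w
      = fderiv ℝ G z u v w + fderiv ℝ G z v u w - fderiv ℝ G z w u v := by
  rw [leviCivita, hG.apply_inverse]
  simp

/-- How the Christoffel symbols change under a change of coordinates `ψ`. -/
theorem fderiv_leviCivita {G' : E → E →L[ℝ] E →L[ℝ] ℝ} {ψ : E → E}
    (hψ : ContDiffAt ℝ 2 ψ z) (hinv : Function.Surjective (fderiv ℝ ψ z))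
    (hG : IsScalarProduct (G z)) (hG' : IsScalarProduct (G' (ψ z)))
    (hG'd : DifferentiableAt ℝ G' (ψ z)) (hGd : DifferentiableAt ℝ G z)
    (h : ∀ᶠ y in 𝓝 z, ∀ u v, G y u v = G' (ψ y) (fderiv ℝ ψ y u) (fderiv ℝ ψ y v)) (u v : E) :
    fderiv ℝ ψ z (leviCivita G z u v)
      = leviCivita G' (ψ z) (fderiv ℝ ψ z u) (fderiv ℝ ψ z v) + fderiv ℝ (fderiv ℝ ψ) z u v := by
  have hψ1 : HasFDerivAt ψ (fderiv ℝ ψ z) z :=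
    (hψ.differentiableAt (by norm_num)).hasFDerivAt
  have hψ2 : HasFDerivAt (fderiv ℝ ψ) (fderiv ℝ (fderiv ℝ ψ) z) z :=
    ((hψ.fderiv_right (m := 1) (by norm_num)).differentiableAt (by norm_num)).hasFDerivAt
  have hsymm : ∀ a b, fderiv ℝ (fderiv ℝ ψ) z a b = fderiv ℝ (fderiv ℝ ψ) z b a :=
    fun a b ↦ (hψ.isSymmSndFDerivAt (by simp)).eq a b
  have key : ∀ a b c, fderiv ℝ G z a b c
      = fderiv ℝ G' (ψ z) (fderiv ℝ ψ z a) (fderiv ℝ ψ z b) (fderiv ℝ ψ z c)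
        + G' (ψ z) (fderiv ℝ (fderiv ℝ ψ) z a b) (fderiv ℝ ψ z c)
        + G' (ψ z) (fderiv ℝ ψ z b) (fderiv ℝ (fderiv ℝ ψ) z a c) := by
    intro a b c
    have hb : HasFDerivAt (fun y ↦ fderiv ℝ ψ y b) _ z := hψ2.clm_apply (hasFDerivAt_const b z)
    have hc : HasFDerivAt (fun y ↦ fderiv ℝ ψ y c) _ z := hψ2.clm_apply (hasFDerivAt_const c z)
    have h1 := ((hG'd.hasFDerivAt.comp z hψ1).clm_apply hb).clm_apply hc
    have h2 := (hGd.hasFDerivAt.clm_apply (hasFDerivAt_const b z)).clm_apply (hasFDerivAt_const c z)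
    -- Both sides of the isometry relation `h`, at fixed `b` and `c`, are differentiated at `z`.
    have h3 := h2.unique (h1.congr_of_eventuallyEq (h.mono fun y hy ↦ hy b c))
    have h4 := DFunLike.congr_fun h3 a
    simp at h4
    rw [h4]
    ring
  obtain hz := h.self_of_nhds
  apply hG'.eq_of_forall
  intro w'
  obtain ⟨w, rfl⟩ := hinv w'
  have e1 := apply_leviCivita hG u v w
  have e2 := apply_leviCivita hG' (fderiv ℝ ψ z u) (fderiv ℝ ψ z v) (fderiv ℝ ψ z w)
  rw [key, key, key, hz] at e1
  simp only [map_add, add_apply]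
  have s1 := hG'.symm (fderiv ℝ (fderiv ℝ ψ) z u w) (fderiv ℝ ψ z v)
  have s2 := hG'.symm (fderiv ℝ (fderiv ℝ ψ) z v w) (fderiv ℝ ψ z u)
  -- By symmetry of `D²ψ`, the second-order terms cancel except for twice `G'(D²ψ(u,v), Dψ w)`.
  rw [hsymm w u, hsymm w v, hsymm v u, s1] at e1
  linarith

/-- The Christoffel symbols of a metric in a conformal class, on the diagonal. -/
theorem leviCivita_smul {a : E → ℝ} (hG : IsScalarProduct (G z)) (hGd : DifferentiableAt ℝ G z)
    (had : DifferentiableAt ℝ a z) (ha : 0 < a z) {n : E} (hn : G z n = fderiv ℝ a z) (u : E) :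
    leviCivita (fun y ↦ a y • G y) z u u = leviCivita G z u u
      + (a z)⁻¹ • (fderiv ℝ a z u • u - (G z u u / 2) • n) := by
  have hd : ∀ x y w, fderiv ℝ (fun y ↦ a y • G y) z x y w
      = a z * fderiv ℝ G z x y w + fderiv ℝ a z x * G z y w := by
    intro x y w
    rw [fderiv_fun_smul had hGd]
    simp
  have hS : IsScalarProduct ((fun y ↦ a y • G y) z) := hG.smul ha
  apply hS.eq_of_forall
  intro w
  have e1 := apply_leviCivita (G := fun y ↦ a y • G y) hS u u w
  have e2 := apply_leviCivita hG u u w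
  rw [hd, hd] at e1
  have hnw : G z n w = fderiv ℝ a z w := by rw [hn]
  simp only [map_add, map_smul, map_sub, add_apply,
    sub_apply, smul_apply, smul_eq_mul, hnw] at e1 ⊢
  field_simp
  linear_combination e1 - a z * e2

/-- The second derivative of `log a` along a curve satisfying the geodesic equation of `a • G`. -/
theorem deriv_deriv_log_comp {a : E → ℝ} {c : ℝ → E} {t : ℝ} (hc : ContDiffAt ℝ 2 c t)
    (hG : IsScalarProduct (G (c t))) (hGd : DifferentiableAt ℝ G (c t))
    (had : ContDiffAt ℝ 2 a (c t)) (ha : ∀ y, 0 < a y) {n : E}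
    (hn : G (c t) n = fderiv ℝ a (c t))
    (hgeo : deriv (deriv c) t
      + leviCivita (fun y ↦ a y • G y) (c t) (deriv c t) (deriv c t) = 0) :
    deriv (deriv fun r ↦ Real.log (a (c r))) t = (2 * a (c t) ^ 2)⁻¹ *
      (2 * a (c t) * (fderiv ℝ (fderiv ℝ a) (c t) (deriv c t) (deriv c t)
          - fderiv ℝ a (c t) (leviCivita G (c t) (deriv c t) (deriv c t)))
        + G (c t) n n * G (c t) (deriv c t) (deriv c t)
        - 4 * fderiv ℝ a (c t) (deriv c t) ^ 2) := by
  have hcd : ∀ᶠ r in 𝓝 t, DifferentiableAt ℝ c r :=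
    (hc.eventually (by simp)).mono fun r hr ↦ hr.differentiableAt (by norm_num)
  have had1 : ∀ᶠ y in 𝓝 (c t), DifferentiableAt ℝ a y :=
    (had.eventually (by simp)).mono fun r hr ↦ hr.differentiableAt (by norm_num)
  have had2 : ∀ᶠ r in 𝓝 t, DifferentiableAt ℝ a (c r) := hc.continuousAt.eventually had1
  -- The first derivative is needed on a neighbourhood of `t`, since it is differentiated again.
  have h1 : deriv (fun r ↦ Real.log (a (c r))) =ᶠ[𝓝 t]
      fun r ↦ fderiv ℝ a (c r) (deriv c r) / a (c r) := by
    filter_upwards [hcd, had2] with r h1 h2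
    exact ((h2.hasFDerivAt.comp_hasDerivAt r h1.hasDerivAt).log (ha _).ne').deriv
  rw [h1.deriv_eq]
  have hc1 : HasDerivAt c (deriv c t) t := hcd.self_of_nhds.hasDerivAt
  have hc2 : HasDerivAt (deriv c) (deriv (deriv c) t) t := by
    have : ContDiffAt ℝ 1 (deriv c) t := by
      have := (hc.fderiv_right (m := 1) (by norm_num)).clm_apply
        (contDiffAt_const (c := (1 : ℝ)))
      simpa using this
    exact (this.differentiableAt (by norm_num)).hasDerivAt
  have ha1 : HasFDerivAt a (fderiv ℝ a (c t)) (c t) := had1.self_of_nhds.hasFDerivAt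
  have ha2 : HasFDerivAt (fderiv ℝ a) (fderiv ℝ (fderiv ℝ a) (c t)) (c t) :=
    ((had.fderiv_right (m := 1) (by norm_num)).differentiableAt (by norm_num)).hasFDerivAt
  have h2 := (((ha2.comp_hasDerivAt t hc1).clm_apply hc2).div (ha1.comp_hasDerivAt t hc1)
    (ha _).ne').deriv
  have hdd : deriv (deriv c) t = -(leviCivita G (c t) (deriv c t) (deriv c t)
      + (a (c t))⁻¹ • (fderiv ℝ a (c t) (deriv c t) • deriv c t
        - (G (c t) (deriv c t) (deriv c t) / 2) • n)) := by
    rw [← leviCivita_smul hG hGd had1.self_of_nhds (ha _) hn]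
    exact eq_neg_of_add_eq_zero_left hgeo
  have hp := ha (c t)
  have hnn : fderiv ℝ a (c t) n = G (c t) n n := by rw [hn]
  have h3 : deriv (fun r ↦ fderiv ℝ a (c r) (deriv c r) / a (c r)) t = _ := h2
  rw [h3, hdd]
  simp only [Function.comp_apply, map_neg, map_add, map_smul, map_sub, smul_eq_mul, hnn]
  field_simp
  ring

/-- Inversion of operators is smooth at invertible ones, so only the derivative of `G` costs
regularity. A `C²` metric thus has a `C¹` geodesic field, enough for Picard–Lindelöf. -/
theorem contDiffAt_leviCivita [CompleteSpace E] {n : WithTop ℕ∞} (hG : IsScalarProduct (G z))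
    (hGd : ContDiffAt ℝ (n + 1) G z) (v : E) :
    ContDiffAt ℝ n (fun p : E × E ↦ leviCivita G p.1 p.2 p.2) (z, v) := by
  have h1 : ContDiffAt ℝ n (fun p : E × E ↦ (G p.1).inverse) (z, v) := by
    obtain ⟨e, he⟩ := hG.isInvertible
    have := contDiffAt_map_inverse (n := n) e
    rw [he] at this
    exact ContDiffAt.comp (z, v) (g := ContinuousLinearMap.inverse) (f := fun p : E × E ↦ G p.1) this
      ((hGd.of_le le_self_add).comp (z, v) contDiffAt_fst)
  have h2 : ContDiffAt ℝ n (fun p : E × E ↦ fderiv ℝ G p.1) (z, v) :=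
    ContDiffAt.comp (z, v) (g := fderiv ℝ G) (f := fun p : E × E ↦ p.1)
      (hGd.fderiv_right le_rfl) contDiffAt_fst
  have hs : ContDiffAt ℝ n (fun p : E × E ↦ p.2) (z, v) := contDiffAt_snd
  have hA : ContDiffAt ℝ n (fun p : E × E ↦ fderiv ℝ G p.1 p.2 p.2) (z, v) :=
    (h2.clm_apply hs).clm_apply hs
  have hB : ContDiffAt ℝ n (fun p : E × E ↦ ((fderiv ℝ G p.1).flip p.2).flip p.2) (z, v) :=
    (contDiffAt_flip ((contDiffAt_flip h2).clm_apply hs)).clm_apply hs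
  exact h1.clm_apply (((hA.add hA).sub hB).const_smul (1 / 2 : ℝ))

/-- Local existence of geodesics in coordinates. -/
theorem exists_curve_leviCivita [CompleteSpace E] {U : Set E} (hU : IsOpen U) (hz : z ∈ U)
    (hG : ∀ y ∈ U, IsScalarProduct (G y)) (hGd : ContDiffOn ℝ 2 G U) (v : E) :
    ∃ (c : ℝ → E) (ε : ℝ), 0 < ε ∧ c 0 = z ∧ deriv c 0 = v ∧ (∀ t ∈ Ioo (-ε) ε, c t ∈ U) ∧
      ContDiffOn ℝ 2 c (Ioo (-ε) ε) ∧ ∀ t ∈ Ioo (-ε) ε,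
        deriv (deriv c) t + leviCivita G (c t) (deriv c t) (deriv c t) = 0 := by
  have hΓ : ∀ p : E × E, p.1 ∈ U →
      ContDiffAt ℝ 1 (fun p : E × E ↦ leviCivita G p.1 p.2 p.2) p := fun p hp ↦
    contDiffAt_leviCivita (hG _ hp)
      (((hGd _ hp).contDiffAt (hU.mem_nhds hp)).of_le (by norm_num)) p.2
  -- The geodesic equation as a first-order system for position and velocity.
  have hf : ContDiffAt ℝ 1 (fun p : E × E ↦ (p.2, -leviCivita G p.1 p.2 p.2)) (z, v) :=
    contDiffAt_snd.prodMk (hΓ (z, v) hz).neg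
  obtain ⟨p, hp0, ε, hε, hp⟩ :=
    hf.exists_forall_mem_closedBall_exists_eq_forall_mem_Ioo_hasDerivAt₀ 0
  have hc0 : ContinuousAt (fun t ↦ (p t).1) 0 :=
    continuousAt_fst.comp (hp 0 (by simp [hε])).continuousAt
  obtain ⟨δ, hδ, hδU⟩ := Metric.mem_nhds_iff.1
    (hc0.preimage_mem_nhds (hU.mem_nhds (by simpa [hp0] using hz)))
  set η := min ε δ with hη
  have hηpos : 0 < η := lt_min hε hδ
  have hsub : ∀ t ∈ Ioo (-η) η, HasDerivAt p ((p t).2, -leviCivita G (p t).1 (p t).2 (p t).2) t := by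
    intro t ht
    have h1 := min_le_left ε δ
    exact hp t ⟨by linarith [ht.1], by linarith [ht.2]⟩
  have hmem : ∀ t ∈ Ioo (-η) η, (p t).1 ∈ U := by
    intro t ht
    have h1 := min_le_right ε δ
    apply hδU
    rw [Metric.mem_ball, Real.dist_eq, sub_zero, abs_lt]
    exact ⟨by linarith [ht.1], by linarith [ht.2]⟩
  have hc : ∀ t ∈ Ioo (-η) η, HasDerivAt (fun t ↦ (p t).1) (p t).2 t := fun t ht ↦ (hsub t ht).fst
  have hv : ∀ t ∈ Ioo (-η) η, HasDerivAt (fun t ↦ (p t).2)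
      (-leviCivita G (p t).1 (p t).2 (p t).2) t := fun t ht ↦ (hsub t ht).snd
  have hdc : ∀ t ∈ Ioo (-η) η, deriv (fun t ↦ (p t).1) =ᶠ[𝓝 t] fun t ↦ (p t).2 := fun t ht ↦ by
    filter_upwards [isOpen_Ioo.mem_nhds ht] with r hr using (hc r hr).deriv
  have h0 : (0 : ℝ) ∈ Ioo (-η) η := by simp [hηpos]
  refine ⟨fun t ↦ (p t).1, η, hηpos, by simp [hp0], by rw [(hc 0 h0).deriv, hp0], hmem, ?_, ?_⟩
  · have hpc : ContinuousOn p (Ioo (-η) η) :=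
      fun t ht ↦ (hsub t ht).continuousAt.continuousWithinAt
    -- Bootstrapping: the acceleration is a continuous function of `p`, so the velocity is `C¹` and
    -- the curve `C²`.
    have hv1 : ContDiffOn ℝ 1 (fun t ↦ (p t).2) (Ioo (-η) η) := by
      rw [show (1 : WithTop ℕ∞) = 0 + 1 by norm_num, contDiffOn_succ_iff_deriv_of_isOpen isOpen_Ioo]
      refine ⟨fun t ht ↦ (hv t ht).differentiableAt.differentiableWithinAt, by simp, ?_⟩
      rw [contDiffOn_zero]
      refine ContinuousOn.congr (fun t ht ↦ ?_) fun t ht ↦ (hv t ht).deriv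
      exact (ContinuousAt.comp (g := fun p : E × E ↦ -leviCivita G p.1 p.2 p.2)
        (hΓ _ (hmem t ht)).neg.continuousAt (hsub t ht).continuousAt).continuousWithinAt
    rw [show (2 : WithTop ℕ∞) = 1 + 1 by norm_num, contDiffOn_succ_iff_deriv_of_isOpen isOpen_Ioo]
    exact ⟨fun t ht ↦ (hc t ht).differentiableAt.differentiableWithinAt, by simp,
      hv1.congr fun t ht ↦ (hc t ht).deriv⟩
  · intro t ht
    rw [(hdc t ht).deriv_eq, (hdc t ht).eq_of_nhds, (hv t ht).deriv]
    simp

/-- The geodesic equation is invariant under changes of coordinates. -/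
theorem geodesic_equation_comp {G' : E → E →L[ℝ] E →L[ℝ] ℝ} {ψ : E → E} {c : ℝ → E} {t : ℝ}
    (hc : ContDiffAt ℝ 2 c t)
    (hψ : ContDiffAt ℝ 2 ψ (c t)) (hinv : Function.Surjective (fderiv ℝ ψ (c t)))
    (hG : IsScalarProduct (G (c t))) (hG' : IsScalarProduct (G' (ψ (c t))))
    (hG'd : DifferentiableAt ℝ G' (ψ (c t))) (hGd : DifferentiableAt ℝ G (c t))
    (h : ∀ᶠ y in 𝓝 (c t), ∀ u v, G y u v = G' (ψ y) (fderiv ℝ ψ y u) (fderiv ℝ ψ y v))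
    (hgeo : deriv (deriv c) t + leviCivita G (c t) (deriv c t) (deriv c t) = 0) :
    deriv (deriv fun r ↦ ψ (c r)) t + leviCivita G' (ψ (c t)) (deriv (fun r ↦ ψ (c r)) t)
      (deriv (fun r ↦ ψ (c r)) t) = 0 := by
  have hcd : ∀ᶠ r in 𝓝 t, DifferentiableAt ℝ c r :=
    (hc.eventually (by simp)).mono fun r hr ↦ hr.differentiableAt (by norm_num)
  have hψ1 : ∀ᶠ r in 𝓝 t, DifferentiableAt ℝ ψ (c r) := hc.continuousAt.eventually
    ((hψ.eventually (by simp)).mono fun r hr ↦ hr.differentiableAt (by norm_num))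
  have hψ2 : HasFDerivAt (fderiv ℝ ψ) (fderiv ℝ (fderiv ℝ ψ) (c t)) (c t) :=
    ((hψ.fderiv_right (m := 1) (by norm_num)).differentiableAt (by norm_num)).hasFDerivAt
  have h1 : deriv (fun r ↦ ψ (c r)) =ᶠ[𝓝 t] fun r ↦ fderiv ℝ ψ (c r) (deriv c r) := by
    filter_upwards [hcd, hψ1] with r h1 h2
    exact (h2.hasFDerivAt.comp_hasDerivAt r h1.hasDerivAt).deriv
  have hc2 : HasDerivAt (deriv c) (deriv (deriv c) t) t := by
    have : ContDiffAt ℝ 1 (deriv c) t := by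
      have := (hc.fderiv_right (m := 1) (by norm_num)).clm_apply
        (contDiffAt_const (c := (1 : ℝ)))
      simpa using this
    exact (this.differentiableAt (by norm_num)).hasDerivAt
  have h2 : deriv (fun r ↦ fderiv ℝ ψ (c r) (deriv c r)) t = _ :=
    ((hψ2.comp_hasDerivAt t hcd.self_of_nhds.hasDerivAt).clm_apply hc2).deriv
  -- The term `D²ψ(c',c')` from the chain rule cancels the one in the transformation law.
  rw [h1.deriv_eq, h1.eq_of_nhds, h2, eq_neg_of_add_eq_zero_left hgeo, map_neg,
    Function.comp_apply, fderiv_leviCivita hψ hinv hG hG' hG'd hGd h]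
  abel

end Calculus

/-! ### The metric and differentials in charts -/

section Coordinates

variable {E : Type*} [NormedAddCommGroup E] [NormedSpace ℝ E]
  {M : Type*} [TopologicalSpace M] [ChartedSpace E M]

/-- Lets a point `y` be replaced everywhere by the image of a coordinate point, so that no transport
between tangent spaces is needed. -/
theorem exists_mem_target {x₀ y : M} (hy : y ∈ (extChartAt 𝓘(ℝ, E) x₀).source) :
    ∃ z ∈ (extChartAt 𝓘(ℝ, E) x₀).target, (extChartAt 𝓘(ℝ, E) x₀).symm z = y :=
  ⟨extChartAt 𝓘(ℝ, E) x₀ y, (extChartAt 𝓘(ℝ, E) x₀).map_source hy,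
    (extChartAt 𝓘(ℝ, E) x₀).left_inv hy⟩

variable [IsManifold 𝓘(ℝ, E) ∞ M]

theorem contMDiffAt_chart_symm {x₀ : M} {z : E} (hz : z ∈ (extChartAt 𝓘(ℝ, E) x₀).target) :
    ContMDiffAt 𝓘(ℝ, E) 𝓘(ℝ, E) ∞ (extChartAt 𝓘(ℝ, E) x₀).symm z :=
  (contMDiffOn_extChartAt_symm x₀).contMDiffAt ((isOpen_extChartAt_target x₀).mem_nhds hz)

theorem contMDiffAt_chart {x₀ y : M} (hy : y ∈ (extChartAt 𝓘(ℝ, E) x₀).source) :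
    ContMDiffAt 𝓘(ℝ, E) 𝓘(ℝ, E) ∞ (extChartAt 𝓘(ℝ, E) x₀) y :=
  contMDiffAt_extChartAt' (by simpa using hy)

/-- The derivative of the chart at `x₀`, with values in the model space. -/
noncomputable def chartDeriv (x₀ y : M) : TangentSpace 𝓘(ℝ, E) y →L[ℝ] E :=
  mfderiv 𝓘(ℝ, E) 𝓘(ℝ, E) (extChartAt 𝓘(ℝ, E) x₀) y

/-- The derivative of the inverse of the chart at `x₀`, defined on the model space. -/
noncomputable def chartSymmDeriv (x₀ : M) (z : E) :
    E →L[ℝ] TangentSpace 𝓘(ℝ, E) ((extChartAt 𝓘(ℝ, E) x₀).symm z) :=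
  mfderiv 𝓘(ℝ, E) 𝓘(ℝ, E) (extChartAt 𝓘(ℝ, E) x₀).symm z

theorem coordMetric_apply (g : Metric E M) (x₀ : M) (z u v : E) :
    coordMetric g x₀ z u v = g.inner ((extChartAt 𝓘(ℝ, E) x₀).symm z)
      (chartSymmDeriv x₀ z u) (chartSymmDeriv x₀ z v) := rfl

theorem chartDeriv_chartSymmDeriv {x₀ : M} {z : E} (hz : z ∈ (extChartAt 𝓘(ℝ, E) x₀).target)
    (u : E) : chartDeriv x₀ ((extChartAt 𝓘(ℝ, E) x₀).symm z) (chartSymmDeriv x₀ z u) = u := by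
  have h := mfderiv_extChartAt_comp_mfderivWithin_extChartAt_symm hz
  rw [modelWithCornersSelf_coe, range_id, mfderivWithin_univ] at h
  exact DFunLike.congr_fun h u

theorem chartSymmDeriv_chartDeriv {x₀ : M} {z : E} (hz : z ∈ (extChartAt 𝓘(ℝ, E) x₀).target)
    (u : TangentSpace 𝓘(ℝ, E) ((extChartAt 𝓘(ℝ, E) x₀).symm z)) :
    chartSymmDeriv x₀ z (chartDeriv x₀ ((extChartAt 𝓘(ℝ, E) x₀).symm z) u) = u := by
  have h := mfderivWithin_extChartAt_symm_comp_mfderiv_extChartAt hz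
  rw [modelWithCornersSelf_coe, range_id, mfderivWithin_univ] at h
  exact DFunLike.congr_fun h u

theorem coordMetric_chartDeriv (g : Metric E M) {x₀ y : M}
    (hy : y ∈ (extChartAt 𝓘(ℝ, E) x₀).source) (u v : TangentSpace 𝓘(ℝ, E) y) :
    coordMetric g x₀ (extChartAt 𝓘(ℝ, E) x₀ y) (chartDeriv x₀ y u) (chartDeriv x₀ y v)
      = g.inner y u v := by
  obtain ⟨z, hz, rfl⟩ := exists_mem_target hy
  rw [(extChartAt 𝓘(ℝ, E) x₀).right_inv hz, coordMetric_apply, chartSymmDeriv_chartDeriv hz,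
    chartSymmDeriv_chartDeriv hz]

theorem chartDeriv_surjective {x₀ y : M} (hy : y ∈ (extChartAt 𝓘(ℝ, E) x₀).source) :
    Function.Surjective (chartDeriv (E := E) x₀ y) := by
  obtain ⟨z, hz, rfl⟩ := exists_mem_target hy
  exact fun u ↦ ⟨_, chartDeriv_chartSymmDeriv hz u⟩

theorem isScalarProduct_coordMetric [FiniteDimensional ℝ E] (g : Metric E M) {x₀ : M} {z : E}
    (hz : z ∈ (extChartAt 𝓘(ℝ, E) x₀).target) : IsScalarProduct (coordMetric g x₀ z) := by
  apply IsScalarProduct.of_finiteDimensional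
  · intro u v
    rw [coordMetric_apply, coordMetric_apply, g.symm]
  · intro u hu
    rw [coordMetric_apply]
    apply g.pos
    intro h
    have h1 := chartDeriv_chartSymmDeriv hz u
    rw [h, map_zero] at h1
    exact hu h1.symm

/-- The coordinate fields `dφ(z) u` are `C²` along the inverse chart `φ`, and a `C²` metric pairs
them to `C²` functions. In finite dimension these entries control the bilinear form. -/
theorem contDiffOn_coordMetric [FiniteDimensional ℝ E] (g : Metric E M) (x₀ : M) :
    ContDiffOn ℝ 2 (coordMetric g x₀) (extChartAt 𝓘(ℝ, E) x₀).target := by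
  have hV : ∀ u : E, ContMDiffOn 𝓘(ℝ, E) (𝓘(ℝ, E).prod 𝓘(ℝ, E)) 2
      (fun z : E ↦ TotalSpace.mk' E (E := fun x : M ↦ TangentSpace 𝓘(ℝ, E) x)
        ((extChartAt 𝓘(ℝ, E) x₀).symm z)
        (chartSymmDeriv x₀ z u))
      (extChartAt 𝓘(ℝ, E) x₀).target := by
    intro u
    -- The tangent map loses one derivative, hence `3` for the inverse chart.
    have h1 := (contMDiffOn_extChartAt_symm (I := 𝓘(ℝ, E)) (n := 3) x₀).contMDiffOn_tangentMapWithin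
      (m := 2) (by norm_num) (isOpen_extChartAt_target x₀).uniqueMDiffOn
    have h2 : ContMDiffOn 𝓘(ℝ, E) (𝓘(ℝ, E).prod 𝓘(ℝ, E)) 2
        (fun z : E ↦ (⟨z, u⟩ : TangentBundle 𝓘(ℝ, E) E)) (extChartAt 𝓘(ℝ, E) x₀).target :=
      contMDiffOn_vectorSpace_iff_contDiffOn.2 contDiffOn_const
    refine (h1.comp h2 fun z hz ↦ hz).congr fun z hz ↦ ?_
    simp only [Function.comp_apply, tangentMapWithin]
    rw [mfderivWithin_of_isOpen (isOpen_extChartAt_target x₀) hz]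
    rfl
  rw [contDiffOn_clm_apply]
  intro u
  rw [contDiffOn_clm_apply]
  intro v
  rw [← contMDiffOn_iff_contDiffOn]
  intro z hz
  have hg := (g.contMDiff.contMDiffAt (x := (extChartAt 𝓘(ℝ, E) x₀).symm z)).comp_contMDiffWithinAt
    z ((contMDiffAt_chart_symm hz).of_le (m := 2) ENat.LEInfty.out).contMDiffWithinAt
      (s := (extChartAt 𝓘(ℝ, E) x₀).target)
  have h := ContMDiffWithinAt.clm_bundle_apply₂ (F₁ := E) (F₂ := E) (F₃ := ℝ)
    (E₃ := Bundle.Trivial M ℝ) hg (hV u z hz) (hV v z hz)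
  exact ((contMDiffWithinAt_totalSpace.1 h).2)

theorem contDiffAt_transition {x₀ x₁ : M} {z : E} (hz : z ∈ (extChartAt 𝓘(ℝ, E) x₀).target)
    (hz1 : (extChartAt 𝓘(ℝ, E) x₀).symm z ∈ (extChartAt 𝓘(ℝ, E) x₁).source) :
    ContDiffAt ℝ ∞ (fun y ↦ extChartAt 𝓘(ℝ, E) x₁ ((extChartAt 𝓘(ℝ, E) x₀).symm y)) z :=
  contMDiffAt_iff_contDiffAt.1 ((contMDiffAt_chart hz1).comp z (contMDiffAt_chart_symm hz))

theorem fderiv_transition {x₀ x₁ : M} {z : E} (hz : z ∈ (extChartAt 𝓘(ℝ, E) x₀).target)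
    (hz1 : (extChartAt 𝓘(ℝ, E) x₀).symm z ∈ (extChartAt 𝓘(ℝ, E) x₁).source) (u : E) :
    fderiv ℝ (fun y ↦ extChartAt 𝓘(ℝ, E) x₁ ((extChartAt 𝓘(ℝ, E) x₀).symm y)) z u
      = chartDeriv x₁ ((extChartAt 𝓘(ℝ, E) x₀).symm z) (chartSymmDeriv x₀ z u) := by
  rw [← mfderiv_eq_fderiv]
  exact DFunLike.congr_fun (mfderiv_comp z
    ((contMDiffAt_chart hz1).mdifferentiableAt (by simp))
    ((contMDiffAt_chart_symm hz).mdifferentiableAt (by simp))) u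

theorem fderiv_transition_surjective {x₀ x₁ : M} {z : E}
    (hz : z ∈ (extChartAt 𝓘(ℝ, E) x₀).target)
    (hz1 : (extChartAt 𝓘(ℝ, E) x₀).symm z ∈ (extChartAt 𝓘(ℝ, E) x₁).source) :
    Function.Surjective
      (fderiv ℝ (fun y ↦ extChartAt 𝓘(ℝ, E) x₁ ((extChartAt 𝓘(ℝ, E) x₀).symm y)) z) := by
  intro w
  obtain ⟨v, rfl⟩ := chartDeriv_surjective hz1 w
  exact ⟨chartDeriv x₀ _ v, by rw [fderiv_transition hz hz1, chartSymmDeriv_chartDeriv hz]⟩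

theorem coordMetric_transition (g : Metric E M) {x₀ x₁ : M} {z : E}
    (hz : z ∈ (extChartAt 𝓘(ℝ, E) x₀).target)
    (hz1 : (extChartAt 𝓘(ℝ, E) x₀).symm z ∈ (extChartAt 𝓘(ℝ, E) x₁).source) (u v : E) :
    coordMetric g x₀ z u v = coordMetric g x₁
      (extChartAt 𝓘(ℝ, E) x₁ ((extChartAt 𝓘(ℝ, E) x₀).symm z))
      (fderiv ℝ (fun y ↦ extChartAt 𝓘(ℝ, E) x₁ ((extChartAt 𝓘(ℝ, E) x₀).symm y)) z u)
      (fderiv ℝ (fun y ↦ extChartAt 𝓘(ℝ, E) x₁ ((extChartAt 𝓘(ℝ, E) x₀).symm y)) z v) := by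
  rw [fderiv_transition hz hz1, fderiv_transition hz hz1, coordMetric_chartDeriv g hz1,
    coordMetric_apply]

theorem contDiffAt_coordMetric [FiniteDimensional ℝ E] (g : Metric E M) {x₀ : M} {z : E}
    (hz : z ∈ (extChartAt 𝓘(ℝ, E) x₀).target) : ContDiffAt ℝ 2 (coordMetric g x₀) z :=
  (contDiffOn_coordMetric g x₀).contDiffAt ((isOpen_extChartAt_target x₀).mem_nhds hz)

theorem contDiffAt_comp_chart_symm {n : WithTop ℕ∞} [ENat.LEInfty n] {f : M → ℝ}
    (hf : ContMDiff 𝓘(ℝ, E) 𝓘(ℝ, ℝ) n f) {x₀ : M} {z : E}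
    (hz : z ∈ (extChartAt 𝓘(ℝ, E) x₀).target) :
    ContDiffAt ℝ n (fun y ↦ f ((extChartAt 𝓘(ℝ, E) x₀).symm y)) z :=
  contMDiffAt_iff_contDiffAt.1
    (hf.contMDiffAt.comp z ((contMDiffAt_chart_symm hz).of_le ENat.LEInfty.out))

theorem fderiv_chartDeriv {f : M → ℝ} {x₀ y : M} (hf : MDifferentiableAt 𝓘(ℝ, E) 𝓘(ℝ, ℝ) f y)
    (hy : y ∈ (extChartAt 𝓘(ℝ, E) x₀).source) (u : TangentSpace 𝓘(ℝ, E) y) :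
    fderiv ℝ (fun z ↦ f ((extChartAt 𝓘(ℝ, E) x₀).symm z)) (extChartAt 𝓘(ℝ, E) x₀ y)
      (chartDeriv x₀ y u) = mvfderiv 𝓘(ℝ, E) f y u := by
  obtain ⟨z, hz, rfl⟩ := exists_mem_target hy
  rw [(extChartAt 𝓘(ℝ, E) x₀).right_inv hz, ← mfderiv_eq_fderiv]
  have h := DFunLike.congr_fun (mfderiv_comp z hf
    ((contMDiffAt_chart_symm hz).mdifferentiableAt (by simp)))
      (chartDeriv x₀ ((extChartAt 𝓘(ℝ, E) x₀).symm z) u)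
  refine h.trans ?_
  exact congrArg (mvfderiv 𝓘(ℝ, E) f _) (chartSymmDeriv_chartDeriv hz u)

/-- The dual norm of a differential, computed in coordinates. -/
theorem dualNorm_sq [FiniteDimensional ℝ E] (g : Metric E M) {f : M → ℝ} {x₀ y : M}
    (hf : MDifferentiableAt 𝓘(ℝ, E) 𝓘(ℝ, ℝ) f y) (hy : y ∈ (extChartAt 𝓘(ℝ, E) x₀).source) {n : E}
    (hn : coordMetric g x₀ (extChartAt 𝓘(ℝ, E) x₀ y) n
      = fderiv ℝ (fun z ↦ f ((extChartAt 𝓘(ℝ, E) x₀).symm z)) (extChartAt 𝓘(ℝ, E) x₀ y)) :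
    dualNorm g y (mvfderiv 𝓘(ℝ, E) f y) ^ 2
      = coordMetric g x₀ (extChartAt 𝓘(ℝ, E) x₀ y) n n := by
  rw [← (isScalarProduct_coordMetric g ((extChartAt 𝓘(ℝ, E) x₀).map_source hy)).sSup_sq hn,
    dualNorm]
  -- The chart derivative matches the two unit balls and the values of the form on them.
  congr 2
  ext r
  constructor
  · rintro ⟨u, hu, rfl⟩
    exact ⟨chartDeriv x₀ y u, by rwa [coordMetric_chartDeriv g hy], by rw [fderiv_chartDeriv hf hy]⟩
  · rintro ⟨u', hu, rfl⟩
    obtain ⟨u, rfl⟩ := chartDeriv_surjective hy u'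
    exact ⟨u, by rwa [coordMetric_chartDeriv g hy] at hu, by rw [fderiv_chartDeriv hf hy]⟩

end Coordinates

/-! ### Second-order chain rule and regularity of compositions -/

theorem fderiv_fderiv_comp {E : Type*} [NormedAddCommGroup E] [NormedSpace ℝ E] {r : E → ℝ} {z : E}
    {h h' : ℝ → ℝ} {h'' : ℝ} (hr : ContDiffAt ℝ 2 r z)
    (h1 : ∀ᶠ s in 𝓝 (r z), HasDerivAt h (h' s) s) (h2 : HasDerivAt h' h'' (r z)) (a b : E) :
    fderiv ℝ (fderiv ℝ fun y ↦ h (r y)) z a b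
      = h'' * fderiv ℝ r z a * fderiv ℝ r z b + h' (r z) * fderiv ℝ (fderiv ℝ r) z a b := by
  have hrd : ∀ᶠ y in 𝓝 z, DifferentiableAt ℝ r y :=
    (hr.eventually (by simp)).mono fun y hy ↦ hy.differentiableAt (by norm_num)
  have e : (fderiv ℝ fun y ↦ h (r y)) =ᶠ[𝓝 z] fun y ↦ h' (r y) • fderiv ℝ r y := by
    filter_upwards [hrd, hr.continuousAt.eventually h1] with y hy hy'
    exact (hy'.comp_hasFDerivAt y hy.hasFDerivAt).fderiv
  have hr2 : HasFDerivAt (fderiv ℝ r) (fderiv ℝ (fderiv ℝ r) z) z :=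
    ((hr.fderiv_right (m := 1) (by norm_num)).differentiableAt (by norm_num)).hasFDerivAt
  have hh := (h2.comp_hasFDerivAt z hrd.self_of_nhds.hasFDerivAt).smul hr2
  have hh' : fderiv ℝ (fun y ↦ h' (r y) • fderiv ℝ r y) z = _ := hh.fderiv
  rw [e.fderiv_eq, hh']
  simp
  ring

theorem contDiffOn_log_comp {E : Type*} [NormedAddCommGroup E] [NormedSpace ℝ E]
    {M : Type*} [TopologicalSpace M] [ChartedSpace E M] {α : M → ℝ}
    (hα : ContMDiff 𝓘(ℝ, E) 𝓘(ℝ, ℝ) 2 α) (hpos : ∀ x, 0 < α x) {γ : ℝ → M} {s : Set ℝ}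
    (hγ : ContMDiffOn 𝓘(ℝ, ℝ) 𝓘(ℝ, E) 2 γ s) :
    ContDiffOn ℝ 2 (fun t ↦ Real.log (α (γ t))) s :=
  (contMDiffOn_iff_contDiffOn.1 (hα.comp_contMDiffOn hγ)).log fun t _ ↦ (hpos (γ t)).ne'

/-! ### Hessians of compositions and the quadratic form -/

section Manifold

variable {E : Type*} [NormedAddCommGroup E] [NormedSpace ℝ E]
  {M : Type*} [TopologicalSpace M] [ChartedSpace E M] [IsManifold 𝓘(ℝ, E) ∞ M]

/-- The symbols on the manifold unfold to those of the coordinate metric, so the vector-space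
results apply. -/
theorem hessian_eq (g : Metric E M) (f : M → ℝ) (x : M) (u v : TangentSpace 𝓘(ℝ, E) x) :
    hessian g f x u v
      = fderiv ℝ (fderiv ℝ fun y ↦ f ((extChartAt 𝓘(ℝ, E) x).symm y)) (extChartAt 𝓘(ℝ, E) x x)
          (chartDeriv x x u) (chartDeriv x x v)
        - fderiv ℝ (fun y ↦ f ((extChartAt 𝓘(ℝ, E) x).symm y)) (extChartAt 𝓘(ℝ, E) x x)
          (leviCivita (coordMetric g x) (extChartAt 𝓘(ℝ, E) x x)
            (chartDeriv x x u) (chartDeriv x x v)) := rfl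

theorem dualNorm_smul (g : Metric E M) (x : M) (c : ℝ) (l : TangentSpace 𝓘(ℝ, E) x →L[ℝ] ℝ) :
    dualNorm g x (c • l) = |c| * dualNorm g x l := by
  rw [dualNorm, dualNorm, ← smul_eq_mul, ← Real.sSup_smul_of_nonneg (abs_nonneg c)]
  congr 1
  ext r
  simp only [mem_ofPred_eq, mem_smul_set]
  constructor
  · rintro ⟨u, hu, rfl⟩
    exact ⟨_, ⟨u, hu, rfl⟩, by simp [abs_mul]⟩
  · rintro ⟨_, ⟨u, hu, rfl⟩, rfl⟩
    exact ⟨u, hu, by simp [abs_mul]⟩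

variable {f : M → ℝ} {h h' : ℝ → ℝ} {h'' : ℝ} {x : M}

theorem fderiv_coord_comp (hf : ContMDiff 𝓘(ℝ, E) 𝓘(ℝ, ℝ) 2 f)
    (h1 : HasDerivAt h (h' (f x)) (f x)) :
    fderiv ℝ (fun y ↦ h (f ((extChartAt 𝓘(ℝ, E) x).symm y))) (extChartAt 𝓘(ℝ, E) x x)
      = h' (f x) • fderiv ℝ (fun y ↦ f ((extChartAt 𝓘(ℝ, E) x).symm y))
          (extChartAt 𝓘(ℝ, E) x x) := by
  have hd := (contDiffAt_comp_chart_symm hf (mem_extChartAt_target (I := 𝓘(ℝ, E)) x))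
  have hx := extChartAt_to_inv (I := 𝓘(ℝ, E)) x
  have h1' : HasDerivAt h (h' (f x))
      ((fun y ↦ f ((extChartAt 𝓘(ℝ, E) x).symm y)) (extChartAt 𝓘(ℝ, E) x x)) := by
    simpa [hx] using h1
  exact (HasDerivAt.comp_hasFDerivAt (h₂ := h) (f := fun y ↦ f ((extChartAt 𝓘(ℝ, E) x).symm y)) _ h1'
    (hd.differentiableAt (by norm_num)).hasFDerivAt).fderiv

theorem mvfderiv_comp_real (hf : ContMDiff 𝓘(ℝ, E) 𝓘(ℝ, ℝ) 2 f)
    (hhf : MDifferentiableAt 𝓘(ℝ, E) 𝓘(ℝ, ℝ) (fun y ↦ h (f y)) x)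
    (h1 : HasDerivAt h (h' (f x)) (f x)) :
    mvfderiv 𝓘(ℝ, E) (fun y ↦ h (f y)) x = h' (f x) • mvfderiv 𝓘(ℝ, E) f x := by
  ext u
  have hx := mem_extChartAt_source (I := 𝓘(ℝ, E)) x
  rw [← fderiv_chartDeriv hhf hx, fderiv_coord_comp hf h1, smul_apply, smul_apply,
    fderiv_chartDeriv (hf.mdifferentiable (by norm_num) x) hx]

/-- The Christoffel correction is linear in the differential, so it only acquires the factor `h'`;
the `h''` term comes from the flat second derivative. -/
theorem hessian_comp (g : Metric E M) (hf : ContMDiff 𝓘(ℝ, E) 𝓘(ℝ, ℝ) 2 f)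
    (h1 : ∀ᶠ s in 𝓝 (f x), HasDerivAt h (h' s) s) (h2 : HasDerivAt h' h'' (f x))
    (u : TangentSpace 𝓘(ℝ, E) x) :
    hessian g (fun y ↦ h (f y)) x u u
      = h'' * mvfderiv 𝓘(ℝ, E) f x u ^ 2 + h' (f x) * hessian g f x u u := by
  have hd := (contDiffAt_comp_chart_symm hf (mem_extChartAt_target (I := 𝓘(ℝ, E)) x))
  have hx := extChartAt_to_inv (I := 𝓘(ℝ, E)) x
  have key := fderiv_fderiv_comp (h := h) (h' := h') (h'' := h'') hd (by simpa only [hx] using h1)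
    (by simpa only [hx] using h2) (chartDeriv x x u) (chartDeriv x x u)
  rw [hessian_eq, hessian_eq, key, fderiv_coord_comp hf h1.self_of_nhds,
    fderiv_chartDeriv (hf.mdifferentiable (by norm_num) x) (mem_extChartAt_source x), hx]
  simp
  ring

/-- The quadratic form whose sign characterizes self-convexity. -/
noncomputable def convexityForm (g : Metric E M) (α : M → ℝ) (x : M)
    (u : TangentSpace 𝓘(ℝ, E) x) : ℝ :=
  2 * α x * hessian g α x u u + dualNorm g x (mvfderiv 𝓘(ℝ, E) α x) ^ 2 * normSq g x u
    - 4 * (mvfderiv 𝓘(ℝ, E) α x u) ^ 2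

theorem hessian_sq (g : Metric E M) {ρ : M → ℝ} (hρ : ContMDiff 𝓘(ℝ, E) 𝓘(ℝ, ℝ) 2 ρ) (x : M)
    (u : TangentSpace 𝓘(ℝ, E) x) :
    hessian g (fun y ↦ ρ y ^ 2) x u u
      = 2 * mvfderiv 𝓘(ℝ, E) ρ x u ^ 2 + 2 * ρ x * hessian g ρ x u u := by
  refine hessian_comp (h := fun s ↦ s ^ 2) (h' := fun s ↦ 2 * s) g hρ
    (.of_forall fun s ↦ by simpa using hasDerivAt_pow 2 s) ?_ u
  simpa using (hasDerivAt_id (ρ x)).const_mul (2 : ℝ)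

/-- With `h = s⁻²`, `h' = -2 s⁻³` and `h'' = 6 s⁻⁴`, the coefficient of `(Dρ u)²` is `(12 - 16)/ρ⁶`;
the other two terms carry `4/ρ⁶` as well, up to sign. -/
theorem convexityForm_inv_sq (g : Metric E M) {ρ : M → ℝ} (hρ : ContMDiff 𝓘(ℝ, E) 𝓘(ℝ, ℝ) 2 ρ)
    (hα : ContMDiff 𝓘(ℝ, E) 𝓘(ℝ, ℝ) 2 fun x ↦ 1 / ρ x ^ 2) (hne : ∀ x, ρ x ≠ 0) (x : M)
    (u : TangentSpace 𝓘(ℝ, E) x) :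
    convexityForm g (fun x ↦ 1 / ρ x ^ 2) x u = 4 / ρ x ^ 6 *
      (normSq g x u * dualNorm g x (mvfderiv 𝓘(ℝ, E) ρ x) ^ 2 - (mvfderiv 𝓘(ℝ, E) ρ x u) ^ 2
        - ρ x * hessian g ρ x u u) := by
  have h1 : ∀ s : ℝ, s ≠ 0 → HasDerivAt (fun s : ℝ ↦ 1 / s ^ 2) (-2 / s ^ 3) s := by
    intro s hs
    convert! (hasDerivAt_const s (1 : ℝ)).div (hasDerivAt_pow 2 s) (pow_ne_zero 2 hs) using 1
    field_simp
    simp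
  have h2 : HasDerivAt (fun s : ℝ ↦ -2 / s ^ 3) (6 / ρ x ^ 4) (ρ x) := by
    have hs := hne x
    convert! (hasDerivAt_const (ρ x) (-2 : ℝ)).div (hasDerivAt_pow 3 (ρ x)) (pow_ne_zero 3 hs)
      using 1
    field_simp
    norm_num
  have e1 := hessian_comp (h := fun s ↦ 1 / s ^ 2) (h' := fun s ↦ -2 / s ^ 3) g hρ
    ((eventually_ne_nhds (hne x)).mono h1) h2 u
  have e2 := mvfderiv_comp_real (h := fun s ↦ 1 / s ^ 2) (h' := fun s ↦ -2 / s ^ 3) hρ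
    (hα.mdifferentiable (by norm_num) x) (h1 _ (hne x))
  have hs := hne x
  rw [convexityForm, e1, e2, dualNorm_smul, mul_pow, sq_abs, smul_apply, smul_eq_mul]
  field_simp
  ring

/-! ### Self-convexity through geodesics -/

variable [FiniteDimensional ℝ E]

variable (g : Metric E M) {α : M → ℝ} (hα : ContMDiff 𝓘(ℝ, E) 𝓘(ℝ, ℝ) 2 α) (hpos : ∀ x, 0 < α x)

/-- Along a geodesic of the condition metric, the second derivative of `log α` is a positive
multiple of `convexityForm`. -/
theorem deriv_deriv_log_of_geodesic {γ : ℝ → M} {t : ℝ}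
    (hγ : ContMDiffAt 𝓘(ℝ, ℝ) 𝓘(ℝ, E) 2 γ t) (hx : γ t = x)
    (hgeo : let c : ℝ → E := fun r ↦ extChartAt 𝓘(ℝ, E) x (γ r)
      deriv (deriv c) t
        + christoffel (conditionMetric g α hα hpos) x (c t) (deriv c t) (deriv c t) = 0)
    {u : TangentSpace 𝓘(ℝ, E) x}
    (hu : chartDeriv x x u = deriv (fun r ↦ extChartAt 𝓘(ℝ, E) x (γ r)) t) :
    deriv (deriv fun r ↦ Real.log (α (γ r))) t = (2 * α x ^ 2)⁻¹ * convexityForm g α x u := by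
  have hxs := mem_extChartAt_source (I := 𝓘(ℝ, E)) x
  have hxt := mem_extChartAt_target (I := 𝓘(ℝ, E)) x
  have hinv := extChartAt_to_inv (I := 𝓘(ℝ, E)) x
  have hc : ContDiffAt ℝ 2 (fun r ↦ extChartAt 𝓘(ℝ, E) x (γ r)) t := by
    refine contMDiffAt_iff_contDiffAt.1 (ContMDiffAt.comp t ?_ hγ)
    rw [hx]
    exact (contMDiffAt_chart hxs).of_le ENat.LEInfty.out
  have hev : (fun r ↦ Real.log (α (γ r))) =ᶠ[𝓝 t] fun r ↦ Real.log
      ((fun y ↦ α ((extChartAt 𝓘(ℝ, E) x).symm y)) (extChartAt 𝓘(ℝ, E) x (γ r))) := by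
    have : ∀ᶠ r in 𝓝 t, γ r ∈ (extChartAt 𝓘(ℝ, E) x).source :=
      hγ.continuousAt.eventually (by rw [hx]; exact extChartAt_source_mem_nhds x)
    filter_upwards [this] with r hr
    simp only [(extChartAt 𝓘(ℝ, E) x).left_inv hr]
  have hG := isScalarProduct_coordMetric g hxt
  obtain ⟨n, hn⟩ : ∃ n, coordMetric g x (extChartAt 𝓘(ℝ, E) x x) n
      = fderiv ℝ (fun z ↦ α ((extChartAt 𝓘(ℝ, E) x).symm z)) (extChartAt 𝓘(ℝ, E) x x) :=
    ⟨_, hG.apply_inverse _⟩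
  have hmd := hα.mdifferentiable (by norm_num) x
  -- The coordinate form of the condition metric unfolds to `a • G`, so `hgeo` fits as it stands.
  have key := deriv_deriv_log_comp (G := coordMetric g x)
    (a := fun y ↦ α ((extChartAt 𝓘(ℝ, E) x).symm y)) hc
    (by rw [hx]; exact hG)
    (by rw [hx]; exact (contDiffAt_coordMetric g hxt).differentiableAt (by norm_num))
    (by rw [hx]; exact contDiffAt_comp_chart_symm hα hxt) (fun y ↦ hpos _) (n := n)
    (by rw [hx]; exact hn) hgeo
  rw [hev.deriv.deriv_eq, key, hx, ← hu, hinv, coordMetric_chartDeriv g hxs,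
    fderiv_chartDeriv hmd hxs, ← dualNorm_sq g hmd hxs hn, ← hessian_eq]
  rfl

/-- Second-derivative test, using at each time `t` the chart centred at `γ t`, the one in which the
Hessian there is defined. -/
theorem selfConvex_of_nonneg
    (H : ∀ (x : M) (u : TangentSpace 𝓘(ℝ, E) x), 0 ≤ convexityForm g α x u) :
    SelfConvex g α hα hpos := by
  intro γ s hs hsc hgeo
  have hL := contDiffOn_log_comp hα hpos hgeo.1
  have hL' := ((contDiffOn_succ_iff_deriv_of_isOpen (n := 1) hs).1
    (by simpa [one_add_one_eq_two] using hL)).2.2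
  refine convexOn_of_deriv2_nonneg' hsc.convex (hL.differentiableOn (by norm_num))
    (hL'.differentiableOn (by norm_num)) fun t ht ↦ ?_
  obtain ⟨u, hu⟩ := chartDeriv_surjective (mem_extChartAt_source (I := 𝓘(ℝ, E)) (γ t))
    (deriv (fun r ↦ extChartAt 𝓘(ℝ, E) (γ t) (γ r)) t)
  have := deriv_deriv_log_of_geodesic g hα hpos (hgeo.1.contMDiffAt (hs.mem_nhds ht)) rfl
    (hgeo.2 (γ t) t ht (mem_chart_source E (γ t))) hu
  rw [show deriv^[2] (fun t ↦ Real.log (α (γ t))) t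
    = deriv (deriv fun t ↦ Real.log (α (γ t))) t from rfl, this]
  have := H (γ t) u
  positivity

/-- Every tangent vector is the initial velocity of a geodesic. -/
theorem exists_geodesic (x : M) (u : TangentSpace 𝓘(ℝ, E) x) :
    ∃ (γ : ℝ → M) (ε : ℝ), 0 < ε ∧ γ 0 = x ∧ IsGeodesicOn g γ (Ioo (-ε) ε) ∧
      chartDeriv x x u = deriv (fun r ↦ extChartAt 𝓘(ℝ, E) x (γ r)) 0 := by
  have : CompleteSpace E := FiniteDimensional.complete ℝ E
  obtain ⟨c, ε, hε, hc0, hdc0, hmem, hcd, hgeo⟩ := exists_curve_leviCivita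
    (G := coordMetric g x) (isOpen_extChartAt_target x) (mem_extChartAt_target (I := 𝓘(ℝ, E)) x)
    (fun y hy ↦ isScalarProduct_coordMetric g hy) (contDiffOn_coordMetric g x) (chartDeriv x x u)
  have h0 : (0 : ℝ) ∈ Ioo (-ε) ε := by simp [hε]
  refine ⟨fun r ↦ (extChartAt 𝓘(ℝ, E) x).symm (c r), ε, hε, ?_, ⟨?_, ?_⟩, ?_⟩
  · simp [hc0]
  · exact ((contMDiffOn_extChartAt_symm x).of_le (n := ∞) ENat.LEInfty.out).comp
      (contMDiffOn_iff_contDiffOn.2 hcd) hmem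
  -- The curve solves the equation in the chart at `x`; a geodesic must solve it in every chart,
  -- hence the transition map.
  · intro x₁ t ht ht1
    rw [← extChartAt_source 𝓘(ℝ, E)] at ht1
    have hz := hmem t ht
    have hψ := (contDiffAt_transition hz ht1)
    refine geodesic_equation_comp (G := coordMetric g x) (G' := coordMetric g x₁)
      (hcd.contDiffAt (isOpen_Ioo.mem_nhds ht)) (hψ.of_le ENat.LEInfty.out)
      (fderiv_transition_surjective hz ht1) (isScalarProduct_coordMetric g hz)
      (isScalarProduct_coordMetric g ((extChartAt 𝓘(ℝ, E) x₁).map_source ht1))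
      ((contDiffAt_coordMetric g ((extChartAt 𝓘(ℝ, E) x₁).map_source ht1)).differentiableAt
        (by norm_num))
      ((contDiffAt_coordMetric g hz).differentiableAt (by norm_num)) ?_ (hgeo t ht)
    filter_upwards [(isOpen_extChartAt_target x).mem_nhds hz,
      (contMDiffAt_chart_symm hz).continuousAt.preimage_mem_nhds
        ((isOpen_extChartAt_source x₁).mem_nhds ht1)] with y hy hy1
    exact coordMetric_transition g hy hy1
  · rw [← hdc0]
    apply Filter.EventuallyEq.deriv_eq
    filter_upwards [isOpen_Ioo.mem_nhds h0] with r hr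
    rw [(extChartAt 𝓘(ℝ, E) x).right_inv (hmem r hr)]

/-- Along the geodesic with initial velocity `u`, convexity makes the first derivative of `log α`
monotone, so its derivative at `0` is nonnegative. -/
theorem nonneg_of_selfConvex (H : SelfConvex g α hα hpos) (x : M) (u : TangentSpace 𝓘(ℝ, E) x) :
    0 ≤ convexityForm g α x u := by
  obtain ⟨γ, ε, hε, hx, hgeo, hu⟩ := exists_geodesic (conditionMetric g α hα hpos) x u
  have h0 : (0 : ℝ) ∈ Ioo (-ε) ε := by simp [hε]
  have hL := contDiffOn_log_comp hα hpos hgeo.1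
  have hmono := (H γ _ isOpen_Ioo ordConnected_Ioo hgeo).monotoneOn_deriv fun t ht ↦
    (hL.differentiableOn (by norm_num)).differentiableAt (isOpen_Ioo.mem_nhds ht)
  have hd := hmono.derivWithin_nonneg (x := 0)
  rw [derivWithin_of_isOpen isOpen_Ioo h0, deriv_deriv_log_of_geodesic g hα hpos
    (hgeo.1.contMDiffAt (isOpen_Ioo.mem_nhds h0)) hx
    (hgeo.2 x 0 h0 (by rw [hx]; exact mem_chart_source E x)) hu] at hd
  have hp := hpos x
  exact nonneg_of_mul_nonneg_right hd (by positivity)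

theorem selfConvex_iff : SelfConvex g α hα hpos ↔
    ∀ (x : M) (u : TangentSpace 𝓘(ℝ, E) x), 0 ≤ convexityForm g α x u :=
  ⟨nonneg_of_selfConvex g hα hpos, selfConvex_of_nonneg g hα hpos⟩

end Manifold

end SelfConvexity

open SelfConvexity in
theorem mainTheorem8
    {E : Type*} [NormedAddCommGroup E] [NormedSpace ℝ E] [FiniteDimensional ℝ E]
    {M : Type*} [TopologicalSpace M] [ChartedSpace E M] [IsManifold 𝓘(ℝ, E) ∞ M]
    (g : Metric E M) (α : M → ℝ)
    (hα : ContMDiff 𝓘(ℝ, E) 𝓘(ℝ, ℝ) 2 α) (hpos : ∀ x, 0 < α x) :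
    (SelfConvex g α hα hpos ↔
      ∀ (x : M) (u : TangentSpace 𝓘(ℝ, E) x),
        0 ≤ 2 * α x * hessian g α x u u
          + dualNorm g x (mvfderiv 𝓘(ℝ, E) α x) ^ 2 * normSq g x u
          - 4 * (mvfderiv 𝓘(ℝ, E) α x u) ^ 2) ∧
    ∀ ρ : M → ℝ, ContMDiff 𝓘(ℝ, E) 𝓘(ℝ, ℝ) 2 ρ → (∀ x, ρ x ≠ 0) →
      (∀ x, α x = 1 / ρ x ^ 2) →
      (SelfConvex g α hα hpos ↔
        ∀ (x : M) (u : TangentSpace 𝓘(ℝ, E) x),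
          0 ≤ normSq g x u * dualNorm g x (mvfderiv 𝓘(ℝ, E) ρ x) ^ 2
            - (mvfderiv 𝓘(ℝ, E) ρ x u) ^ 2
            - ρ x * hessian g ρ x u u) ∧
      (SelfConvex g α hα hpos ↔
        ∀ (x : M) (u : TangentSpace 𝓘(ℝ, E) x),
          hessian g (fun y ↦ ρ y ^ 2) x u u
            ≤ 2 * normSq g x u * dualNorm g x (mvfderiv 𝓘(ℝ, E) ρ x) ^ 2) := by
  refine ⟨selfConvex_iff g hα hpos, fun ρ hρ hne hαρ ↦ ?_⟩
  obtain rfl : α = fun x ↦ 1 / ρ x ^ 2 := funext hαρ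
  have key : SelfConvex g _ hα hpos ↔ ∀ (x : M) (u : TangentSpace 𝓘(ℝ, E) x),
      0 ≤ normSq g x u * dualNorm g x (mvfderiv 𝓘(ℝ, E) ρ x) ^ 2
        - (mvfderiv 𝓘(ℝ, E) ρ x u) ^ 2 - ρ x * hessian g ρ x u u := by
    rw [selfConvex_iff]
    refine forall_congr' fun x ↦ forall_congr' fun u ↦ ?_
    have hs := hne x
    rw [convexityForm_inv_sq g hρ hα hne, mul_nonneg_iff_of_pos_left (by positivity)]
  refine ⟨key, key.trans (forall_congr' fun x ↦ forall_congr' fun u ↦ ?_)⟩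
  rw [hessian_sq g hρ]
  constructor <;> intro h <;> linarith
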